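/- Let $M$ be a smooth $n$-dimensional manifold (Hausdorff, second countable, without boundary) and let $\xi$ be a smooth real line bundle over $M$ with total space $E(\xi)$. Let $\mathcal{G}(M)$ be the group of diffeomorphisms of $M$, let $\mathbf{Aut}(\xi)$ be the group of automorphisms of $\xi$, i.e. of diffeomorphisms $\widetilde\psi$ of $E(\xi)$ that cover some diffeomorphism $\psi$ of $M$ and map each fibre $\xi_x$ linearly to $\xi_{\psi(x)}$, and let $\mathcal{F}(M)$ be the multiplicative group of smooth nowhere vanishing functions $M\to\mathbb{R}$. Let $w_1(\xi)\in H^1(M,\mathbb{Z}_2)$ be the first Stiefel–Whitney class of $\xi$, and let $$\mathcal{G}_\xi(M)=\{\phi\in\mathcal{G}(M)\mid \phi^*(w_1(\xi))=w_1(\xi)\}.$$ 1. A diffeomorphism $\psi:M\to M$ admits a lift to an automorphism $\widetilde\psi:E(\xi)\to E(\xi)$ (that is, an automorphism of $\xi$ covering $\psi$) if and only if $\psi^*(w_1(\xi))=w_1(\xi)$. 2. The sequence of group homomorphisms $$1\to\mathcal{F}(M)\to\mathbf{Aut}(\xi)\to\mathcal{G}_\xi(M)\to 1$$ is well defined and exact.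 Here the first map sends $f$ to the automorphism that multiplies the fibre over $x$ by $f(x)$, and the second sends an automorphism to the diffeomorphism of $M$ that it covers. -/

import Mathlib

open scoped Manifold ContDiff
open Bundle

set_option linter.unusedSectionVars false

noncomputable section

namespace RealLineBundle

/-! ### Singular cohomology with coefficients in `ℤ/2` -/

section SingularCohomology

/-- Singular `k`-simplices of `X`: continuous maps from the standard `k`-simplex to `X`. -/
abbrev SingularSimplex (k : ℕ) (X : Type*) [TopologicalSpace X] : Type _ :=
  C(stdSimplex ℝ (Fin (k + 1)), X)

/-- The `i`-th face of a singular simplex (the vertex `i` is omitted). -/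
def SingularSimplex.face {k : ℕ} {X : Type*} [TopologicalSpace X]
    (σ : SingularSimplex (k + 1) X) (i : Fin (k + 2)) : SingularSimplex k X :=
  σ.comp ⟨stdSimplex.map i.succAbove, stdSimplex.continuous_map _⟩

/-- Singular `k`-cochains with values in `ℤ/2`. -/
abbrev Cochain (k : ℕ) (X : Type*) [TopologicalSpace X] : Type _ :=
  SingularSimplex k X → ZMod 2

/-- The singular coboundary `(δ c)(σ) = ∑ᵢ (-1)ⁱ c(∂ᵢ σ)`. -/
def coboundary (k : ℕ) (X : Type*) [TopologicalSpace X] :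
    Cochain k X →ₗ[ZMod 2] Cochain (k + 1) X where
  toFun c σ := ∑ i : Fin (k + 2), (-1) ^ (i : ℕ) * c (σ.face i)
  map_add' c d := by
    funext σ
    simp [mul_add, Finset.sum_add_distrib]
  map_smul' r c := by
    funext σ
    simp [Finset.mul_sum, mul_left_comm]

theorem coboundary_zero_apply {X : Type*} [TopologicalSpace X] (c : Cochain 0 X)
    (σ : SingularSimplex 1 X) : coboundary 0 X c σ = c (σ.face 0) + c (σ.face 1) := by
  have h : (-1 : ZMod 2) = 1 := by decide
  simp [coboundary, Fin.sum_univ_two, h]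

theorem coboundary_one_apply {X : Type*} [TopologicalSpace X] (c : Cochain 1 X)
    (σ : SingularSimplex 2 X) :
    coboundary 1 X c σ = c (σ.face 0) + c (σ.face 1) + c (σ.face 2) := by
  have h : (-1 : ZMod 2) = 1 := by decide
  simp [coboundary, Fin.sum_univ_three, h]

theorem face_face {k : ℕ} {X : Type*} [TopologicalSpace X] (σ : SingularSimplex (k + 2) X)
    (i : Fin (k + 3)) (j : Fin (k + 2)) (i' : Fin (k + 3)) (j' : Fin (k + 2))
    (h : ∀ l, i.succAbove (j.succAbove l) = i'.succAbove (j'.succAbove l)) :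
    (σ.face i).face j = (σ.face i').face j' := by
  ext x
  have h' : i.succAbove ∘ j.succAbove = i'.succAbove ∘ j'.succAbove := funext h
  have key := congrArg (fun g => stdSimplex.map (S := ℝ) g x) h'
  simp only [← stdSimplex.map_comp_apply] at key
  exact congrArg σ key

/-- Coboundaries are cocycles. -/
theorem range_coboundary_le_ker (X : Type*) [TopologicalSpace X] :
    LinearMap.range (coboundary 0 X) ≤ LinearMap.ker (coboundary 1 X) := by
  rintro _ ⟨c, rfl⟩
  rw [LinearMap.mem_ker]
  funext σ
  rw [coboundary_one_apply]
  simp only [coboundary_zero_apply]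
  rw [face_face σ 1 0 0 0 (by decide), face_face σ 2 0 0 1 (by decide),
    face_face σ 2 1 1 1 (by decide)]
  have h2 : ∀ a b d : ZMod 2, a + b + (a + d) + (b + d) = 0 := by decide
  exact h2 _ _ _

/-- The singular cohomology group `H¹(X; ℤ/2)`: cocycles modulo coboundaries. -/
abbrev H1 (X : Type*) [TopologicalSpace X] : Type _ :=
  LinearMap.ker (coboundary 1 X) ⧸
    (LinearMap.range (coboundary 0 X)).submoduleOf (LinearMap.ker (coboundary 1 X))

/-- Pullback of cochains along a continuous map: `(f^* c)(σ) = c(f ∘ σ)`. -/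
def cochainPullback {X Y : Type*} [TopologicalSpace X] [TopologicalSpace Y] (f : C(X, Y))
    (k : ℕ) : Cochain k Y →ₗ[ZMod 2] Cochain k X where
  toFun c σ := c (f.comp σ)
  map_add' _ _ := rfl
  map_smul' _ _ := rfl

theorem coboundary_cochainPullback {X Y : Type*} [TopologicalSpace X] [TopologicalSpace Y]
    (f : C(X, Y)) (k : ℕ) (c : Cochain k Y) :
    coboundary k X (cochainPullback f k c) = cochainPullback f (k + 1) (coboundary k Y c) := rfl

/-- Pullback of cocycles. -/
def cocyclePullback {X Y : Type*} [TopologicalSpace X] [TopologicalSpace Y] (f : C(X, Y)) :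
    LinearMap.ker (coboundary 1 Y) →ₗ[ZMod 2] LinearMap.ker (coboundary 1 X) :=
  (cochainPullback f 1).restrict fun c hc => by
    rw [LinearMap.mem_ker] at hc ⊢
    rw [coboundary_cochainPullback, hc, map_zero]

/-- The map `f^* : H¹(Y; ℤ/2) → H¹(X; ℤ/2)` induced by a continuous map `f : X → Y`. -/
def H1.pullback {X Y : Type*} [TopologicalSpace X] [TopologicalSpace Y] (f : C(X, Y)) :
    H1 Y →ₗ[ZMod 2] H1 X :=
  Submodule.mapQ _ _ (cocyclePullback f) (by
    rintro ⟨_, hc⟩ ⟨b, rfl⟩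
    exact ⟨cochainPullback f 0 b, rfl⟩)

theorem H1.pullback_id (X : Type*) [TopologicalSpace X] (w : H1 X) :
    H1.pullback (ContinuousMap.id X) w = w := by
  obtain ⟨c, rfl⟩ := Submodule.Quotient.mk_surjective _ w
  rfl

theorem H1.pullback_comp {X Y Z : Type*} [TopologicalSpace X] [TopologicalSpace Y]
    [TopologicalSpace Z] (g : C(Y, Z)) (f : C(X, Y)) (w : H1 Z) :
    H1.pullback (g.comp f) w = H1.pullback f (H1.pullback g w) := by
  obtain ⟨c, rfl⟩ := Submodule.Quotient.mk_surjective _ w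
  rfl

end SingularCohomology

/-! ### The first Stiefel-Whitney class of a real line bundle -/

section StiefelWhitney

variable {B : Type*} [TopologicalSpace B]
  (E : B → Type*) [∀ x, AddCommGroup (E x)] [∀ x, Module ℝ (E x)]
  [TopologicalSpace (TotalSpace ℝ E)] [∀ x, TopologicalSpace (E x)]
  [FiberBundle ℝ E] [VectorBundle ℝ ℝ E]

/-- A nonzero reference vector in each fibre (in general not continuous in the base point);
it fixes an orientation of each single fibre. -/
def referenceVector (x : B) : E x :=
  (trivializationAt ℝ E x).symm x (1 : ℝ)

theorem referenceVector_ne_zero (x : B) : referenceVector E x ≠ 0 := by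
  intro h
  have hx := FiberBundle.mem_baseSet_trivializationAt' (F := ℝ) (E := E) x
  have h1 := (trivializationAt ℝ E x).linearMapAt_symm (R := ℝ) hx (1 : ℝ)
  have h2 : (trivializationAt ℝ E x).symm x (1 : ℝ) = 0 := h
  rw [h2, map_zero] at h1
  exact zero_ne_one h1

/-- Transport along the path `σ` carries the reference orientation of the fibre over its initial
point to that of the fibre over its end point: the pulled back bundle `σ^* E` has a continuous
nowhere vanishing section which at both ends is a positive multiple of the reference vector. -/
def PreservesOrientation (σ : SingularSimplex 1 B) : Prop :=
  ∃ s : ∀ t, E (σ t),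
    Continuous (fun t => TotalSpace.mk' ℝ (σ t) (s t)) ∧ (∀ t, s t ≠ 0) ∧
      ∀ i : Fin 2, ∃ a : ℝ, 0 < a ∧
        s (stdSimplex.vertex i) = a • referenceVector E (σ (stdSimplex.vertex i))

open Classical in
/-- The orientation cochain: its value on a path is `0` if transport along the path preserves the
reference orientations, and `1` if it reverses them. -/
def orientationCochain : Cochain 1 B :=
  fun σ => if PreservesOrientation E σ then 0 else 1

/-! The orientation cochain is a cocycle: a real line bundle pulled back to a square, and hence
one pulled back to a triangle, has a continuous nowhere vanishing section. -/

variable {E}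

/-- The linear coordinate on a fibre. -/
def fibreCoord (x : B) : E x ≃ₗ[ℝ] ℝ :=
  (trivializationAt ℝ E x).linearEquivAt ℝ x (FiberBundle.mem_baseSet_trivializationAt' x)

/-- The quotient of two vectors of a fibre. -/
def fibreRatio {x : B} (v w : E x) : ℝ := fibreCoord x v / fibreCoord x w

theorem fibreRatio_smul {x : B} (v : E x) {w : E x} (hw : w ≠ 0) : fibreRatio v w • w = v := by
  apply (fibreCoord (E := E) x).injective
  have : fibreCoord x w ≠ 0 := by simpa using hw
  rw [map_smul, smul_eq_mul, fibreRatio, div_mul_cancel₀ _ this]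

theorem fibreRatio_ne_zero {x : B} {v w : E x} (hv : v ≠ 0) (hw : w ≠ 0) :
    fibreRatio v w ≠ 0 := by
  intro h
  have := fibreRatio_smul v hw
  rw [h, zero_smul] at this
  exact hv this.symm

theorem fibreRatio_of_eq_smul {x : B} {v w : E x} (hw : w ≠ 0) {a : ℝ} (h : v = a • w) :
    fibreRatio v w = a := by
  have hc : fibreCoord x w ≠ 0 := by simpa using hw
  rw [h, fibreRatio, map_smul, smul_eq_mul, mul_div_cancel_right₀ _ hc]

theorem fibreRatio_eq {x : B} (e : Trivialization ℝ (π ℝ E)) [e.IsLinear ℝ] (hx : x ∈ e.baseSet)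
    (v w : E x) (hw : w ≠ 0) : fibreRatio v w = (e ⟨x, v⟩).2 / (e ⟨x, w⟩).2 := by
  have hv := fibreRatio_smul v hw
  have h1 : (e ⟨x, v⟩).2 = fibreRatio v w * (e ⟨x, w⟩).2 := by
    have := congrArg (e.linearEquivAt ℝ x hx) hv
    rw [map_smul] at this
    exact this.symm
  have h2 : (e ⟨x, w⟩).2 ≠ 0 := by
    have : e.linearEquivAt ℝ x hx w ≠ 0 := (e.linearEquivAt ℝ x hx).map_ne_zero_iff.2 hw
    exact this
  rw [h1, mul_div_cancel_right₀ _ h2]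

variable {T : Type*} [TopologicalSpace T]

theorem continuousOn_fibreRatio {γ : T → B} {S : Set T} {s s' : ∀ t, E (γ t)}
    (hs : ContinuousOn (fun t => TotalSpace.mk' ℝ (γ t) (s t)) S)
    (hs' : ContinuousOn (fun t => TotalSpace.mk' ℝ (γ t) (s' t)) S)
    (h0 : ∀ t ∈ S, s' t ≠ 0) : ContinuousOn (fun t => fibreRatio (s t) (s' t)) S := by
  intro t ht
  have h1 := (FiberBundle.continuousWithinAt_totalSpace ℝ _).1 (hs t ht)
  have h2 := (FiberBundle.continuousWithinAt_totalSpace ℝ _).1 (hs' t ht)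
  have hb : γ t ∈ (trivializationAt ℝ E (γ t)).baseSet :=
    FiberBundle.mem_baseSet_trivializationAt' _
  have hne : ((trivializationAt ℝ E (γ t)) ⟨γ t, s' t⟩).2 ≠ 0 := by
    have : (trivializationAt ℝ E (γ t)).linearEquivAt ℝ (γ t) hb (s' t) ≠ 0 :=
      (LinearEquiv.map_ne_zero_iff _).2 (h0 t ht)
    exact this
  refine (h1.2.div h2.2 hne).congr_of_eventuallyEq_of_mem ?_ ht
  have hn : ∀ᶠ t' in nhdsWithin t S, γ t' ∈ (trivializationAt ℝ E (γ t)).baseSet :=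
    h1.1 ((trivializationAt ℝ E (γ t)).open_baseSet.mem_nhds hb)
  filter_upwards [hn, self_mem_nhdsWithin] with t' ht' hS
  exact fibreRatio_eq _ ht' _ _ (h0 t' hS)

theorem continuousOn_smul_section {γ : T → B} {S : Set T} {r : T → ℝ} {s : ∀ t, E (γ t)}
    (hr : ContinuousOn r S) (hs : ContinuousOn (fun t => TotalSpace.mk' ℝ (γ t) (s t)) S) :
    ContinuousOn (fun t => TotalSpace.mk' ℝ (γ t) (r t • s t)) S := by
  intro t ht
  have h1 := (FiberBundle.continuousWithinAt_totalSpace ℝ _).1 (hs t ht)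
  have hb : γ t ∈ (trivializationAt ℝ E (γ t)).baseSet :=
    FiberBundle.mem_baseSet_trivializationAt' _
  refine (FiberBundle.continuousWithinAt_totalSpace ℝ _).2 ⟨h1.1, ?_⟩
  refine ((hr t ht).mul h1.2).congr_of_eventuallyEq_of_mem ?_ ht
  have hn : ∀ᶠ t' in nhdsWithin t S, γ t' ∈ (trivializationAt ℝ E (γ t)).baseSet :=
    h1.1 ((trivializationAt ℝ E (γ t)).open_baseSet.mem_nhds hb)
  filter_upwards [hn] with t' ht'
  exact ((trivializationAt ℝ E (γ t)).linearEquivAt ℝ (γ t') ht').map_smul (r t') (s t')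

variable (E) in
/-- The pullback of the line bundle along `γ` has a continuous nowhere zero section over `S`. -/
def HasFrame (γ : T → B) (S : Set T) : Prop :=
  ∃ s : ∀ t, E (γ t), ContinuousOn (fun t => TotalSpace.mk' ℝ (γ t) (s t)) S ∧ ∀ t ∈ S, s t ≠ 0

theorem HasFrame.mono {γ : T → B} {S S' : Set T} (h : HasFrame E γ S) (hS : S' ⊆ S) :
    HasFrame E γ S' := by
  obtain ⟨s, h1, h2⟩ := h
  exact ⟨s, h1.mono hS, fun t ht => h2 t (hS ht)⟩

theorem hasFrame_of_subset {γ : T → B} (hγ : Continuous γ) {S : Set T} (x : B)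
    (h : S ⊆ γ ⁻¹' (trivializationAt ℝ E x).baseSet) : HasFrame E γ S := by
  refine ⟨fun t => (trivializationAt ℝ E x).symm (γ t) (1 : ℝ), ?_, ?_⟩
  · exact (trivializationAt ℝ E x).continuousOn_symm.comp
      (hγ.prodMk continuous_const).continuousOn fun t ht => ⟨h ht, Set.mem_univ _⟩
  · intro t ht h0
    have h1 := (trivializationAt ℝ E x).linearMapAt_symm (R := ℝ) (h ht) (1 : ℝ)
    have h2 : (trivializationAt ℝ E x).symm (γ t) (1 : ℝ) = 0 := h0
    rw [h2, map_zero] at h1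
    exact zero_ne_one h1

/-- Glueing along a closed set onto which one of the two pieces retracts. -/
theorem HasFrame.union {γ : T → B} {S S' : Set T} (h : HasFrame E γ S) (h' : HasFrame E γ S')
    (hS : IsClosed S) (hS' : IsClosed S') (ρ : T → T) (hρ : Continuous ρ)
    (hm : Set.MapsTo ρ S' (S ∩ S')) (hid : ∀ t ∈ S ∩ S', ρ t = t) : HasFrame E γ (S ∪ S') := by
  classical
  obtain ⟨s, h1, h2⟩ := h
  obtain ⟨s', h1', h2'⟩ := h'
  set r : T → ℝ := fun t => fibreRatio (s t) (s' t) with hr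
  have hrc : ContinuousOn r (S ∩ S') :=
    continuousOn_fibreRatio (h1.mono Set.inter_subset_left) (h1'.mono Set.inter_subset_right)
      fun t ht => h2' t ht.2
  have hrρ : ContinuousOn (r ∘ ρ) S' := hrc.comp hρ.continuousOn hm
  refine ⟨fun t => if t ∈ S then s t else r (ρ t) • s' t, ?_, ?_⟩
  · refine ContinuousOn.union_of_isClosed ?_ ?_ hS hS'
    · refine h1.congr fun t ht => ?_
      simp [ht]
    · refine (continuousOn_smul_section hrρ h1').congr fun t ht => ?_
      by_cases hts : t ∈ S
      · simp only [hts, if_true, Function.comp_apply]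
        rw [hid t ⟨hts, ht⟩, hr]
        simp only [fibreRatio_smul _ (h2' t ht)]
      · simp [hts]
  · intro t ht
    by_cases hts : t ∈ S
    · simpa [hts] using h2 t hts
    · have ht' : t ∈ S' := ht.resolve_left hts
      have hm' := hm ht'
      simpa [hts, h2' t ht'] using fibreRatio_ne_zero (h2 _ hm'.1) (h2' _ hm'.2)

open unitInterval in
theorem hasFrame_square (γ : I × I → B) (hγ : Continuous γ) : HasFrame E γ Set.univ := by
  obtain ⟨τ, h0, hmono, ⟨n, hn⟩, hsub⟩ :=
    exists_monotone_Icc_subset_open_cover_unitInterval_prod_self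
      (c := fun x : B => γ ⁻¹' (trivializationAt ℝ E x).baseSet)
      (fun x => (trivializationAt ℝ E x).open_baseSet.preimage hγ)
      (fun p _ => Set.mem_iUnion.2 ⟨γ p, FiberBundle.mem_baseSet_trivializationAt' _⟩)
  have hclosed : ∀ a b c d : I, IsClosed (Set.Icc a b ×ˢ Set.Icc c d) :=
    fun a b c d => isClosed_Icc.prod isClosed_Icc
  have strip : ∀ i m, HasFrame E γ (Set.Icc (τ i) (τ (i + 1)) ×ˢ Set.Icc 0 (τ m)) := by
    intro i m
    induction m with
    | zero =>
      obtain ⟨x, hx⟩ := hsub i 0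
      refine (hasFrame_of_subset hγ x hx).mono (Set.prod_mono le_rfl ?_)
      exact Set.Icc_subset_Icc h0.le (hmono (Nat.zero_le _))
    | succ m ih =>
      obtain ⟨x, hx⟩ := hsub i m
      have := ih.union (hasFrame_of_subset hγ x hx) (hclosed _ _ _ _) (hclosed _ _ _ _)
        (fun p => (p.1, τ m)) (by fun_prop)
        (fun p hp => ⟨⟨hp.1, unitInterval.nonneg', le_rfl⟩, hp.1, le_rfl, hmono m.le_succ⟩)
        (fun p hp => Prod.ext rfl (le_antisymm hp.2.2.1 hp.1.2.2))
      refine this.mono ?_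
      rintro p ⟨hp1, hp2⟩
      rcases le_total p.2 (τ m) with h | h
      · exact Or.inl ⟨hp1, hp2.1, h⟩
      · exact Or.inr ⟨hp1, h, hp2.2⟩
  have rect : ∀ m, HasFrame E γ (Set.Icc 0 (τ m) ×ˢ Set.Icc 0 (τ n)) := by
    intro m
    induction m with
    | zero =>
      refine (strip 0 n).mono (Set.prod_mono ?_ le_rfl)
      exact Set.Icc_subset_Icc h0.le (hmono (Nat.zero_le _))
    | succ m ih =>
      have := ih.union (strip m n) (hclosed _ _ _ _) (hclosed _ _ _ _)
        (fun p => (τ m, p.2)) (by fun_prop)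
        (fun p hp => ⟨⟨⟨unitInterval.nonneg', le_rfl⟩, hp.2⟩, ⟨le_rfl, hmono m.le_succ⟩, hp.2⟩)
        (fun p hp => Prod.ext (le_antisymm hp.2.1.1 hp.1.1.2) rfl)
      refine this.mono ?_
      rintro p ⟨hp1, hp2⟩
      rcases le_total p.1 (τ m) with h | h
      · exact Or.inl ⟨⟨hp1.1, h⟩, hp2⟩
      · exact Or.inr ⟨⟨h, hp1.2⟩, hp2⟩
  refine (rect n).mono fun p _ => ?_
  rw [hn n le_rfl]
  exact ⟨⟨unitInterval.nonneg', unitInterval.le_one'⟩, unitInterval.nonneg',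
    unitInterval.le_one'⟩

/-- A retraction of the unit square onto the triangle that it contains. -/
def squareToTriangle (p : unitInterval × unitInterval) : stdSimplex ℝ (Fin 3) :=
  ⟨![1 - p.1 - min (p.2 : ℝ) (1 - p.1), p.1, min (p.2 : ℝ) (1 - p.1)], by
    refine ⟨fun i => ?_, ?_⟩
    · have h1 := p.1.2.1
      have h2 := p.1.2.2
      have h3 := p.2.2.1
      have h4 := min_le_right (p.2 : ℝ) (1 - p.1)
      fin_cases i
      · simp
      · simpa using h1
      · simpa using ⟨h3, h2⟩
    · simp only [Fin.sum_univ_three]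
      change 1 - (p.1 : ℝ) - min (p.2 : ℝ) (1 - p.1) + p.1 + min (p.2 : ℝ) (1 - p.1) = 1
      ring⟩

theorem continuous_squareToTriangle : Continuous squareToTriangle := by
  refine Continuous.subtype_mk (continuous_pi fun i => ?_) _
  fin_cases i <;> simp <;> fun_prop

/-- The inclusion of the triangle in the square. -/
def triangleToSquare (p : stdSimplex ℝ (Fin 3)) : unitInterval × unitInterval :=
  (⟨p 1, p.2.1 1, stdSimplex.le_one p 1⟩, ⟨p 2, p.2.1 2, stdSimplex.le_one p 2⟩)

theorem continuous_triangleToSquare : Continuous triangleToSquare := by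
  have h : ∀ i, Continuous fun p : stdSimplex ℝ (Fin 3) => p i :=
    fun i => (continuous_apply i).comp continuous_subtype_val
  exact ((h 1).subtype_mk _).prodMk ((h 2).subtype_mk _)

theorem squareToTriangle_triangleToSquare (p : stdSimplex ℝ (Fin 3)) :
    squareToTriangle (triangleToSquare p) = p := by
  have h := stdSimplex.sum_eq_one p
  have h0 := stdSimplex.zero_le p 0
  rw [Fin.sum_univ_three] at h
  have hmin : min (p 2) (1 - p 1) = p 2 := min_eq_left (by linarith)
  ext i
  change (![1 - p 1 - min (p 2) (1 - p 1), p 1, min (p 2) (1 - p 1)] : Fin 3 → ℝ) i = p i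
  rw [hmin]
  fin_cases i
  · change 1 - p 1 - p 2 = p 0
    linarith
  · rfl
  · rfl

theorem hasFrame_triangle (σ : SingularSimplex 2 B) : HasFrame E σ Set.univ := by
  obtain ⟨s, h1, h2⟩ := hasFrame_square (E := E) (fun p => σ (squareToTriangle p))
    (σ.continuous.comp continuous_squareToTriangle)
  have hq : ∀ p, σ (squareToTriangle (triangleToSquare p)) = σ p := fun p => by
    rw [squareToTriangle_triangleToSquare]
  have heq : ∀ {x y : B} (h : x = y) (v : E x), TotalSpace.mk' ℝ y (h ▸ v) = TotalSpace.mk' ℝ x v ∧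
      (v ≠ 0 → h ▸ v ≠ 0) := by
    rintro x _ rfl v
    exact ⟨rfl, id⟩
  refine ⟨fun p => hq p ▸ s (triangleToSquare p), ?_, fun p _ =>
    (heq (hq p) _).2 (h2 _ (Set.mem_univ _))⟩
  refine ContinuousOn.congr (f := fun p => TotalSpace.mk' ℝ _ (s (triangleToSquare p))) ?_
    fun p _ => (heq (hq p) _).1
  exact h1.comp continuous_triangleToSquare.continuousOn fun _ _ => Set.mem_univ _

/-- Any frame along a path computes whether transport preserves the reference orientations. -/
theorem preservesOrientation_iff (σ : SingularSimplex 1 B) (s : ∀ t, E (σ t))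
    (hs : Continuous fun t => TotalSpace.mk' ℝ (σ t) (s t)) (h0 : ∀ t, s t ≠ 0) :
    PreservesOrientation E σ ↔
      (0 < fibreRatio (s (stdSimplex.vertex 0)) (referenceVector E _) ↔
        0 < fibreRatio (s (stdSimplex.vertex 1)) (referenceVector E _)) := by
  set a : Fin 2 → ℝ := fun i => fibreRatio (s (stdSimplex.vertex i)) (referenceVector E _) with ha
  have hane : ∀ i, a i ≠ 0 := fun i => fibreRatio_ne_zero (h0 _) (referenceVector_ne_zero E _)
  have hsa : ∀ i, s (stdSimplex.vertex i) = a i • referenceVector E _ :=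
    fun i => (fibreRatio_smul _ (referenceVector_ne_zero E _)).symm
  change _ ↔ (0 < a 0 ↔ 0 < a 1)
  constructor
  · rintro ⟨s', hs', h0', hb⟩
    choose b hbpos hb using hb
    have hc : Continuous fun t => fibreRatio (s t) (s' t) := by
      rw [← continuousOn_univ]
      exact continuousOn_fibreRatio hs.continuousOn hs'.continuousOn fun t _ => h0' t
    have hne : ∀ t, fibreRatio (s t) (s' t) ≠ 0 := fun t => fibreRatio_ne_zero (h0 t) (h0' t)
    have hval : ∀ i, fibreRatio (s (stdSimplex.vertex i)) (s' (stdSimplex.vertex i)) = a i / b i := by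
      intro i
      apply fibreRatio_of_eq_smul (h0' _)
      rw [hb, hsa, smul_smul, div_mul_cancel₀ _ (hbpos i).ne']
    have : PreconnectedSpace (stdSimplex ℝ (Fin 2)) :=
      Subtype.preconnectedSpace (convex_stdSimplex ℝ (Fin 2)).isPreconnected
    have hpos : ∀ i, 0 < a i ↔ 0 < fibreRatio (s (stdSimplex.vertex i)) (s' (stdSimplex.vertex i)) :=
      fun i => by rw [hval, div_pos_iff_of_pos_right (hbpos i)]
    rw [hpos, hpos]
    have key : ∀ t t', 0 < fibreRatio (s t) (s' t) → 0 < fibreRatio (s t') (s' t') := by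
      intro t t' ht
      by_contra hcon
      obtain ⟨t'', h''⟩ := mem_range_of_exists_le_of_exists_ge hc ⟨t', not_lt.1 hcon⟩ ⟨t, ht.le⟩
      exact hne t'' h''
    exact ⟨key _ _, key _ _⟩
  · intro h
    by_cases hp : 0 < a 0
    · refine ⟨s, hs, h0, fun i => ⟨a i, ?_, hsa i⟩⟩
      fin_cases i
      · exact hp
      · exact h.1 hp
    · refine ⟨fun t => (-1 : ℝ) • s t, ?_, fun t => by simpa using h0 t, fun i => ⟨-a i, ?_, ?_⟩⟩
      · rw [← continuousOn_univ]
        exact continuousOn_smul_section continuousOn_const hs.continuousOn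
      · have h1 : ¬ 0 < a 1 := fun h1 => hp (h.2 h1)
        rw [neg_pos]
        fin_cases i
        · exact lt_of_le_of_ne (not_lt.1 hp) (hane 0)
        · exact lt_of_le_of_ne (not_lt.1 h1) (hane 1)
      · change (-1 : ℝ) • s _ = _
        rw [hsa, smul_smul, neg_one_mul]

variable (E) in
/-- The orientation cochain is a cocycle. -/
theorem orientationCochain_mem_ker : orientationCochain E ∈ LinearMap.ker (coboundary 1 B) := by
  classical
  rw [LinearMap.mem_ker]
  funext σ
  rw [coboundary_one_apply]
  obtain ⟨s, hs, h0⟩ := hasFrame_triangle (E := E) σ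
  have hs' : Continuous fun t => TotalSpace.mk' ℝ (σ t) (s t) := by
    rwa [← continuousOn_univ]
  have h0' : ∀ t, s t ≠ 0 := fun t => h0 t (Set.mem_univ t)
  let P : Fin 3 → Prop := fun j =>
    0 < fibreRatio (s (stdSimplex.vertex j)) (referenceVector E (σ (stdSimplex.vertex j)))
  have hface : ∀ i : Fin 3, PreservesOrientation E (σ.face i) ↔
      (P (i.succAbove 0) ↔ P (i.succAbove 1)) := by
    intro i
    have h := preservesOrientation_iff (σ.face i)
      (fun t => s (stdSimplex.map i.succAbove t))
      (hs'.comp (stdSimplex.continuous_map i.succAbove)) (fun t => h0' _)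
    have hv : ∀ t t', t = t' →
        (0 < fibreRatio (s t) (referenceVector E (σ t)) ↔
          0 < fibreRatio (s t') (referenceVector E (σ t'))) := by
      rintro t _ rfl
      rfl
    exact h.trans (iff_congr (hv _ _ (stdSimplex.map_vertex _ _))
      (hv _ _ (stdSimplex.map_vertex _ _)))
  simp only [orientationCochain, hface]
  have e00 : (0 : Fin 3).succAbove (0 : Fin 2) = 1 := by decide
  have e01 : (0 : Fin 3).succAbove (1 : Fin 2) = 2 := by decide
  have e10 : (1 : Fin 3).succAbove (0 : Fin 2) = 0 := by decide
  have e11 : (1 : Fin 3).succAbove (1 : Fin 2) = 2 := by decide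
  have e20 : (2 : Fin 3).succAbove (0 : Fin 2) = 0 := by decide
  have e21 : (2 : Fin 3).succAbove (1 : Fin 2) = 1 := by decide
  rw [e00, e01, e10, e11, e20, e21]
  have h11 : (1 : ZMod 2) + 1 = 0 := by decide
  by_cases p0 : P 0 <;> by_cases p1 : P 1 <;> by_cases p2 : P 2 <;> simp [p0, p1, p2, h11]

variable (E) in
/-- The first Stiefel-Whitney class `w₁(E) ∈ H¹(B; ℤ/2)` of a real line bundle: the class of the
orientation cocycle. -/
def stiefelWhitneyClassOne : H1 B :=
  Submodule.Quotient.mk ⟨orientationCochain E, orientationCochain_mem_ker E⟩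

end StiefelWhitney

/-! ### Diffeomorphisms, and automorphisms of a line bundle -/

section Groups

/-- The group of self-diffeomorphisms, with composition as multiplication. -/
instance diffeomorphGroup {V : Type*} [NormedAddCommGroup V] [NormedSpace ℝ V]
    {H : Type*} [TopologicalSpace H] (I : ModelWithCorners ℝ V H)
    (N : Type*) [TopologicalSpace N] [ChartedSpace H N] : Group (Diffeomorph I I N N ∞) where
  mul Φ Ψ := Ψ.trans Φ
  one := Diffeomorph.refl I N ∞
  inv Φ := Φ.symm
  mul_assoc _ _ _ := rfl
  one_mul _ := rfl
  mul_one _ := rfl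
  inv_mul_cancel Φ := Φ.self_trans_symm

variable {n : ℕ} {M : Type*} [TopologicalSpace M] [ChartedSpace (EuclideanSpace ℝ (Fin n)) M]

/-- The group `𝒢(M)` of diffeomorphisms of `M`. -/
abbrev DiffeoGroup (n : ℕ) (M : Type*) [TopologicalSpace M]
    [ChartedSpace (EuclideanSpace ℝ (Fin n)) M] : Type _ :=
  Diffeomorph (𝓡 n) (𝓡 n) M M ∞

/-- The group `ℱ(M)` of nowhere vanishing smooth functions on `M`, under multiplication:
the units of the ring of smooth functions. -/
abbrev NowhereVanishing (n : ℕ) (M : Type*) [TopologicalSpace M]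
    [ChartedSpace (EuclideanSpace ℝ (Fin n)) M] : Type _ :=
  (ContMDiffMap (𝓡 n) 𝓘(ℝ, ℝ) M ℝ ∞)ˣ

/-- The units of the ring of smooth functions are exactly the nowhere vanishing ones. -/
theorem isUnit_iff_nowhereVanishing (f : ContMDiffMap (𝓡 n) 𝓘(ℝ, ℝ) M ℝ ∞) :
    IsUnit f ↔ ∀ x, f x ≠ 0 := by
  constructor
  · rintro ⟨u, rfl⟩ x hx
    have h : ((u : ContMDiffMap (𝓡 n) 𝓘(ℝ, ℝ) M ℝ ∞) *
        ((u⁻¹ : _ˣ) : ContMDiffMap (𝓡 n) 𝓘(ℝ, ℝ) M ℝ ∞)) x = 1 := by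
      rw [Units.mul_inv]
      rfl
    rw [ContMDiffMap.coe_mul, Pi.mul_apply, hx, zero_mul] at h
    exact zero_ne_one h
  · intro h
    refine IsUnit.of_mul_eq_one ⟨fun x => (f x)⁻¹, f.contMDiff.inv₀ h⟩ ?_
    ext x
    exact mul_inv_cancel₀ (h x)

/-- The subgroup `𝒢_w(M)` of the diffeomorphisms `φ` with `φ^* w = w`. -/
def stabilizer (n : ℕ) (M : Type*) [TopologicalSpace M]
    [ChartedSpace (EuclideanSpace ℝ (Fin n)) M] (w : H1 M) : Subgroup (DiffeoGroup n M) where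
  carrier := {φ | H1.pullback ⟨φ, φ.continuous⟩ w = w}
  mul_mem' {φ ψ} hφ hψ := by
    have h := H1.pullback_comp ⟨φ, φ.continuous⟩ ⟨ψ, ψ.continuous⟩ w
    rw [Set.mem_ofPred_eq] at hφ hψ ⊢
    rw [hφ, hψ] at h
    exact h
  one_mem' := H1.pullback_id M w
  inv_mem' {φ} hφ := by
    have h := H1.pullback_comp ⟨φ, φ.continuous⟩ ⟨φ.symm, φ.symm.continuous⟩ w
    rw [Set.mem_ofPred_eq] at hφ ⊢
    have h1 : ContinuousMap.comp (⟨φ, φ.continuous⟩ : C(M, M)) ⟨φ.symm, φ.symm.continuous⟩ =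
        ContinuousMap.id M := by
      ext x
      exact φ.apply_symm_apply x
    rw [h1, H1.pullback_id, hφ] at h
    exact h.symm

variable (n)
  (E : M → Type*) [∀ x, AddCommGroup (E x)] [∀ x, Module ℝ (E x)]
  [TopologicalSpace (TotalSpace ℝ E)] [∀ x, TopologicalSpace (E x)]
  [FiberBundle ℝ E] [VectorBundle ℝ ℝ E] [ContMDiffVectorBundle ∞ ℝ E (𝓡 n)]

/-- The group of diffeomorphisms of the total space. -/
abbrev TotalDiffeoGroup : Type _ :=
  Diffeomorph ((𝓡 n).prod 𝓘(ℝ, ℝ)) ((𝓡 n).prod 𝓘(ℝ, ℝ)) (TotalSpace ℝ E) (TotalSpace ℝ E) ∞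

/-- The automorphism group of the line bundle: pairs of a diffeomorphism `Φ` of the total space and
a diffeomorphism `ψ` of the base such that `Φ` maps each fibre `E x` linearly to `E (ψ x)`.
(The base map `ψ` is determined by `Φ`.) -/
def lineBundleAut : Subgroup (TotalDiffeoGroup n E × DiffeoGroup n M) where
  carrier := {p | ∀ x, ∃ A : E x →ₗ[ℝ] E (p.2 x), ∀ v, p.1 ⟨x, v⟩ = ⟨p.2 x, A v⟩}
  mul_mem' {p q} hp hq := by
    intro x
    obtain ⟨A, hA⟩ := hq x
    obtain ⟨C, hC⟩ := hp (q.2 x)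
    refine ⟨C.comp A, fun v => ?_⟩
    change p.1 (q.1 ⟨x, v⟩) = _
    rw [hA, hC]
    rfl
  one_mem' := fun x => ⟨LinearMap.id, fun v => rfl⟩
  inv_mem' {p} hp := by
    intro x
    change ∃ A : E x →ₗ[ℝ] E (p.2.symm x), ∀ v, p.1.symm ⟨x, v⟩ = ⟨p.2.symm x, A v⟩
    obtain ⟨y, rfl⟩ : ∃ y, p.2 y = x := ⟨p.2.symm x, p.2.apply_symm_apply x⟩
    rw [p.2.symm_apply_apply]
    obtain ⟨A, hA⟩ := hp y
    have hinj : Function.Injective A := by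
      intro v w h
      have h1 : p.1 ⟨y, v⟩ = p.1 ⟨y, w⟩ := by rw [hA, hA, h]
      have h2 := p.1.injective h1
      simpa using h2
    have hsurj : Function.Surjective A := by
      intro w
      obtain ⟨⟨z, v⟩, hz⟩ := p.1.surjective ⟨p.2 y, w⟩
      change p.1 ⟨z, v⟩ = _ at hz
      obtain ⟨C, hC⟩ := hp z
      have h1 := hz
      rw [hC] at h1
      have h2 : z = y := p.2.injective (congrArg TotalSpace.proj h1)
      subst h2
      rw [hA] at hz
      exact ⟨v, by simpa using hz⟩
    refine ⟨(LinearEquiv.ofBijective A ⟨hinj, hsurj⟩).symm, fun w => ?_⟩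
    obtain ⟨v, rfl⟩ := hsurj w
    rw [← hA, p.1.symm_apply_apply]
    congr 1
    exact ((LinearEquiv.ofBijective A ⟨hinj, hsurj⟩).symm_apply_apply v).symm

/-- The homomorphism `Aut(ξ) → 𝒢(M)` taking an automorphism to the diffeomorphism it covers. -/
def autBase : lineBundleAut n E →* DiffeoGroup n M :=
  (MonoidHom.snd _ _).comp (lineBundleAut n E).subtype

/-- An automorphism is determined by its map of total spaces. -/
theorem lineBundleAut_ext (a b : lineBundleAut n E) (h : a.1.1 = b.1.1) : a = b := by
  refine Subtype.ext (Prod.ext h (Diffeomorph.ext fun x => ?_))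
  obtain ⟨A, hA⟩ := a.2 x
  obtain ⟨C, hC⟩ := b.2 x
  have h1 := hA 0
  rw [h, hC] at h1
  exact congrArg TotalSpace.proj h1.symm

variable {n} in
theorem contMDiff_fibreScaling (f : ContMDiffMap (𝓡 n) 𝓘(ℝ, ℝ) M ℝ ∞) :
    ContMDiff ((𝓡 n).prod 𝓘(ℝ, ℝ)) ((𝓡 n).prod 𝓘(ℝ, ℝ)) ∞
      (fun v : TotalSpace ℝ E => (⟨v.proj, f v.proj • v.2⟩ : TotalSpace ℝ E)) := by
  intro v
  rw [contMDiffAt_totalSpace]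
  refine ⟨contMDiffAt_proj E, ?_⟩
  have h1 : ContMDiffAt ((𝓡 n).prod 𝓘(ℝ, ℝ)) 𝓘(ℝ, ℝ) ∞ (fun w : TotalSpace ℝ E => f w.proj) v :=
    (f.contMDiff.contMDiffAt (x := v.proj)).comp v (contMDiffAt_proj E)
  have h2 := (contMDiffAt_totalSpace.1
    (contMDiffAt_id (I := (𝓡 n).prod 𝓘(ℝ, ℝ)) (n := ∞) (x := v))).2
  refine (h1.mul h2).congr_of_eventuallyEq ?_
  have hb : v.proj ∈ (trivializationAt ℝ E v.proj).baseSet :=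
    FiberBundle.mem_baseSet_trivializationAt' _
  have hn : ∀ᶠ w : TotalSpace ℝ E in nhds v, w.proj ∈ (trivializationAt ℝ E v.proj).baseSet :=
    (FiberBundle.continuous_proj ℝ E).continuousAt
      ((trivializationAt ℝ E v.proj).open_baseSet.mem_nhds hb)
  filter_upwards [hn] with w hw
  exact ((trivializationAt ℝ E v.proj).linearEquivAt ℝ w.proj hw).map_smul (f w.proj) w.2

/-- The homomorphism `ℱ(M) → Aut(ξ)`: a nowhere vanishing function `f` acts on the fibre over `x`
as multiplication by `f x`. -/
def scaling : NowhereVanishing n M →* lineBundleAut n E where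
  toFun f :=
    ⟨({ toFun := fun v => ⟨v.proj, f.1 v.proj • v.2⟩
        invFun := fun v => ⟨v.proj, f⁻¹.1 v.proj • v.2⟩
        left_inv := fun v => by
          have h : f⁻¹.1 v.proj * f.1 v.proj = 1 := by
            rw [← Pi.mul_apply, ← ContMDiffMap.coe_mul, Units.inv_mul]
            rfl
          simp only [smul_smul, h, one_smul]
        right_inv := fun v => by
          have h : f.1 v.proj * f⁻¹.1 v.proj = 1 := by
            rw [← Pi.mul_apply, ← ContMDiffMap.coe_mul, Units.mul_inv]
            rfl
          simp only [smul_smul, h, one_smul]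
        contMDiff_toFun := contMDiff_fibreScaling E f.1
        contMDiff_invFun := contMDiff_fibreScaling E f⁻¹.1 }, 1),
      fun x => ⟨f.1 x • LinearMap.id, fun _ => rfl⟩⟩
  map_one' := by
    apply lineBundleAut_ext
    apply Diffeomorph.ext
    intro v
    change (⟨v.proj, (1 : ℝ) • v.2⟩ : TotalSpace ℝ E) = v
    rw [one_smul]
  map_mul' f g := by
    apply lineBundleAut_ext
    apply Diffeomorph.ext
    intro v
    change (⟨v.proj, (f.1 v.proj * g.1 v.proj) • v.2⟩ : TotalSpace ℝ E) =
      ⟨v.proj, f.1 v.proj • g.1 v.proj • v.2⟩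
    rw [smul_smul]

end Groups

end RealLineBundle

end

/-! Fix the reference vector `e_x` in every fibre, with no continuity in `x`. A fibrewise linear
bijection over `ψ` then amounts to a nowhere zero function `r`, via `e_x ↦ r(x) e_{ψ(x)}`.
Smoothness of the bijection is a local condition on `r`: its matrix entry `r(x) κ_{ψ(x₀)}(ψ(x)) /
κ_{x₀}(x)` in the preferred trivializations must be smooth at each `x₀`, where `κ_j` is
`referenceCoord E j`. The Stiefel-Whitney class controls the sign of `r`, and a fibre metric takes
care of its absolute value.

Sign: `w₁` is represented by the cocycle recording which paths reverse the reference orientations.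
Invariance under `ψ` says that this cocycle and its pullback differ by the coboundary of a
0-cochain, which is just a predicate `P` on points (`pullback_stiefelWhitneyClassOne_eq_iff`). A
lift provides such a `P`, namely `r > 0`. Conversely, testing a given `P` on short paths shows that
the sign `ε = ±1` it defines jumps exactly where the relative sign of the reference vectors does
(`eventually_iff_of_transport`).

Absolute value: a partition of unity gives a smooth fibre metric (`exists_norm_referenceVector`).
With `m(x) = ‖e_x‖`, the choice `r = ε · m / (m ∘ ψ)` is an isometric lift, and it is smooth because
its local matrix entries have locally constant sign (`exists_aut_of_pullback_eq`).

This equivalence makes the projection to the stabilizer well defined and surjective. Its kernel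
consists of scalings because a linear endomorphism of a line is a scalar, which inherits smoothness
from the automorphism (`exists_scaling_eq`). -/

namespace RealLineBundle

section StiefelWhitney

variable {B : Type*} [TopologicalSpace B]
  {E : B → Type*} [∀ x, AddCommGroup (E x)] [∀ x, Module ℝ (E x)]
  [TopologicalSpace (TotalSpace ℝ E)] [∀ x, TopologicalSpace (E x)]
  [FiberBundle ℝ E] [VectorBundle ℝ ℝ E]

/-! ### Coordinates relative to the reference vectors -/

/-- The vector over `x` with coordinate `t` with respect to the reference vector. -/
noncomputable def ofCoord (E : B → Type*) [∀ x, AddCommGroup (E x)] [∀ x, Module ℝ (E x)]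
    [TopologicalSpace (TotalSpace ℝ E)] [∀ x, TopologicalSpace (E x)]
    [FiberBundle ℝ E] [VectorBundle ℝ ℝ E] (x : B) (t : ℝ) : TotalSpace ℝ E :=
  ⟨x, t • referenceVector E x⟩

theorem fibreCoord_referenceVector (x : B) : fibreCoord x (referenceVector E x) = 1 := by
  have hx := FiberBundle.mem_baseSet_trivializationAt' (F := ℝ) (E := E) x
  have h1 := (trivializationAt ℝ E x).linearMapAt_symm (R := ℝ) hx (1 : ℝ)
  rw [Trivialization.linearMapAt_apply, if_pos hx] at h1
  exact h1

theorem fibreCoord_smul_referenceVector {x : B} (v : E x) :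
    fibreCoord x v • referenceVector E x = v := by
  apply (fibreCoord (E := E) x).injective
  rw [map_smul, fibreCoord_referenceVector, smul_eq_mul, mul_one]

/-- The coordinate of the reference vector at `x` in the preferred trivialization at `j`. -/
noncomputable def referenceCoord (E : B → Type*) [∀ x, AddCommGroup (E x)] [∀ x, Module ℝ (E x)]
    [TopologicalSpace (TotalSpace ℝ E)] [∀ x, TopologicalSpace (E x)]
    [FiberBundle ℝ E] [VectorBundle ℝ ℝ E] (j x : B) : ℝ :=
  (trivializationAt ℝ E j ⟨x, referenceVector E x⟩).2

theorem trivializationAt_smul {j x : B} (hx : x ∈ (trivializationAt ℝ E j).baseSet) (t : ℝ)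
    (v : E x) : (trivializationAt ℝ E j ⟨x, t • v⟩).2 = t * (trivializationAt ℝ E j ⟨x, v⟩).2 :=
  ((trivializationAt ℝ E j).linearEquivAt ℝ x hx).map_smul t v

theorem trivializationAt_eq {j x : B} (hx : x ∈ (trivializationAt ℝ E j).baseSet) (v : E x) :
    (trivializationAt ℝ E j ⟨x, v⟩).2 = fibreCoord x v * referenceCoord E j x := by
  conv_lhs => rw [← fibreCoord_smul_referenceVector v]
  exact trivializationAt_smul hx _ _

theorem referenceCoord_ne_zero {j x : B} (hx : x ∈ (trivializationAt ℝ E j).baseSet) :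
    referenceCoord E j x ≠ 0 :=
  ((trivializationAt ℝ E j).linearEquivAt ℝ x hx).map_ne_zero_iff.2 (referenceVector_ne_zero E x)

theorem referenceCoord_self (x : B) : referenceCoord E x x = 1 :=
  fibreCoord_referenceVector x

/-! ### Orientation transport and invariance of the first Stiefel-Whitney class -/

/-- Along a path inside a trivializing open set, transport of orientations is read off from the
coordinates of the reference vectors. -/
theorem preservesOrientation_iff_of_subset (j : B) (σ : SingularSimplex 1 B)
    (hσ : ∀ t, σ t ∈ (trivializationAt ℝ E j).baseSet) :
    PreservesOrientation E σ ↔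
      (0 < referenceCoord E j (σ (stdSimplex.vertex 0)) ↔
        0 < referenceCoord E j (σ (stdSimplex.vertex 1))) := by
  have hone : ∀ t, (trivializationAt ℝ E j ⟨σ t, (trivializationAt ℝ E j).symm (σ t) (1 : ℝ)⟩).2
      = 1 := by
    intro t
    have h1 := (trivializationAt ℝ E j).linearMapAt_symm (R := ℝ) (hσ t) (1 : ℝ)
    rwa [Trivialization.linearMapAt_apply, if_pos (hσ t)] at h1
  rw [preservesOrientation_iff σ (fun t => (trivializationAt ℝ E j).symm (σ t) (1 : ℝ))]
  -- The frame has constant coordinate 1, so its ratio to the reference vector is the reciprocal of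
  -- `referenceCoord`, which has the same sign.
  · rw [fibreRatio_eq _ (hσ _) _ _ (referenceVector_ne_zero E _),
      fibreRatio_eq _ (hσ _) _ _ (referenceVector_ne_zero E _), hone, hone, one_div, one_div,
      inv_pos, inv_pos]
    rfl
  · rw [← continuousOn_univ]
    exact (trivializationAt ℝ E j).continuousOn_symm.comp
      (σ.continuous.prodMk continuous_const).continuousOn fun t _ => ⟨hσ t, Set.mem_univ _⟩
  · intro t h
    have h1 := hone t
    have h2 := trivializationAt_smul (hσ t) 0 (0 : E (σ t))
    rw [zero_smul, zero_mul] at h2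
    rw [h, h2] at h1
    exact zero_ne_one h1

/-- A path is an edge of a degenerate triangle: pull it back along a collapse of the triangle onto
an edge, take a frame there, and restrict it to that edge. -/
theorem exists_frame_path (σ : SingularSimplex 1 B) :
    ∃ s : ∀ t, E (σ t), Continuous (fun t => TotalSpace.mk' ℝ (σ t) (s t)) ∧ ∀ t, s t ≠ 0 := by
  let f : Fin 3 → Fin 2 := ![0, 1, 1]
  let g : Fin 2 → Fin 3 := ![0, 1]
  have hfg : f ∘ g = id := by decide
  obtain ⟨s, h1, h2⟩ := hasFrame_triangle (E := E)
    (σ.comp ⟨stdSimplex.map f, stdSimplex.continuous_map f⟩)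
  have hq : ∀ p : stdSimplex ℝ (Fin 2), stdSimplex.map f (stdSimplex.map g p) = p := fun p => by
    rw [stdSimplex.map_comp_apply, hfg, stdSimplex.map_id_apply]
  have heq : ∀ {x y : stdSimplex ℝ (Fin 2)} (h : x = y) (v : E (σ x)),
      TotalSpace.mk' ℝ (σ y) (h ▸ v : E (σ y)) = TotalSpace.mk' ℝ (σ x) v ∧
      (v ≠ 0 → (h ▸ v : E (σ y)) ≠ 0) := by
    rintro x _ rfl v
    exact ⟨rfl, id⟩
  refine ⟨fun p => hq p ▸ s (stdSimplex.map g p), ?_, fun p =>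
    (heq (hq p) _).2 (h2 _ (Set.mem_univ _))⟩
  have h3 : Continuous fun p => TotalSpace.mk' ℝ _ (s (stdSimplex.map g p)) :=
    (continuousOn_univ.1 h1).comp (stdSimplex.continuous_map g)
  exact h3.congr fun p => ((heq (hq p) _).1).symm

theorem vertex_zero_eq (t : stdSimplex ℝ (Fin 1)) : t = stdSimplex.vertex 0 := by
  ext i
  rw [stdSimplex.eq_one_of_unique, stdSimplex.eq_one_of_unique]

theorem face_zero_eq (σ : SingularSimplex 1 B) :
    σ.face 0 = ContinuousMap.const _ (σ (stdSimplex.vertex 1)) := by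
  ext t
  rw [vertex_zero_eq t]
  exact congrArg σ (stdSimplex.map_vertex _ _)

theorem face_one_eq (σ : SingularSimplex 1 B) :
    σ.face 1 = ContinuousMap.const _ (σ (stdSimplex.vertex 0)) := by
  ext t
  rw [vertex_zero_eq t]
  exact congrArg σ (stdSimplex.map_vertex _ _)

/-- The first Stiefel-Whitney class is invariant under `f` iff the fibres of `E` and of `f^* E` can
be oriented relative to each other, compatibly with transport along paths. -/
theorem pullback_stiefelWhitneyClassOne_eq_iff (f : C(B, B)) :
    H1.pullback f (stiefelWhitneyClassOne E) = stiefelWhitneyClassOne E ↔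
      ∃ P : B → Prop, ∀ σ : SingularSimplex 1 B,
        (PreservesOrientation E (f.comp σ) ↔ PreservesOrientation E σ) ↔
          (P (σ (stdSimplex.vertex 0)) ↔ P (σ (stdSimplex.vertex 1))) := by
  classical
  -- Dictionary between additive `ZMod 2` and propositions: zero is true, and a sum vanishes iff
  -- both terms have the same truth value.
  have key : ∀ (p q : Prop) (a b : ZMod 2),
      (b + a = (if p then 0 else 1) - (if q then 0 else 1)) ↔ ((p ↔ q) ↔ (a = 0 ↔ b = 0)) := by
    intro p q
    by_cases hp : p <;> by_cases hq : q <;> simp only [hp, hq, if_true, if_false] <;> decide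
  -- Equality in the quotient unfolds definitionally to the existence of a primitive of the
  -- difference of the two cocycles.
  have h0 : H1.pullback f (stiefelWhitneyClassOne E) = stiefelWhitneyClassOne E ↔
      ∃ b : Cochain 0 B, coboundary 0 B b =
        cochainPullback f 1 (orientationCochain E) - orientationCochain E :=
    Submodule.Quotient.eq _
  rw [h0]
  constructor
  -- A singular 0-simplex is constant, so a 0-cochain with values in `ZMod 2` is a predicate on
  -- points.
  · rintro ⟨b, hb⟩
    refine ⟨fun x => b (ContinuousMap.const _ x) = 0, fun σ => ?_⟩
    have h := congrFun hb σ
    rw [coboundary_zero_apply, face_zero_eq, face_one_eq] at h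
    exact (key _ _ _ _).1 h
  · rintro ⟨P, hP⟩
    refine ⟨fun τ => if P (τ (stdSimplex.vertex 0)) then 0 else 1, ?_⟩
    funext σ
    rw [coboundary_zero_apply, face_zero_eq, face_one_eq]
    refine (key _ _ _ _).2 ((hP σ).trans ?_)
    by_cases h : P (σ (stdSimplex.vertex 0)) <;> by_cases h' : P (σ (stdSimplex.vertex 1)) <;>
      simp [h, h']

/-- Near a point, the relative orientations of `E` and `f^* E` match the local frames. -/
theorem eventually_iff_of_transport [LocallyPathConnectedSpace B] (f : C(B, B)) (P : B → Prop)
    (hP : ∀ σ : SingularSimplex 1 B,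
      (PreservesOrientation E (f.comp σ) ↔ PreservesOrientation E σ) ↔
        (P (σ (stdSimplex.vertex 0)) ↔ P (σ (stdSimplex.vertex 1)))) (x₀ : B) :
    ∀ᶠ x in nhds x₀, (0 < referenceCoord E (f x₀) (f x) ↔ 0 < referenceCoord E x₀ x) ↔
      (P x₀ ↔ P x) := by
  have hU : (trivializationAt ℝ E x₀).baseSet ∩ f ⁻¹' (trivializationAt ℝ E (f x₀)).baseSet ∈
      nhds x₀ :=
    Filter.inter_mem ((trivializationAt ℝ E x₀).open_baseSet.mem_nhds
      (FiberBundle.mem_baseSet_trivializationAt' _))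
      (f.continuous.continuousAt ((trivializationAt ℝ E (f x₀)).open_baseSet.mem_nhds
        (FiberBundle.mem_baseSet_trivializationAt' _)))
  -- The hypothesis `hP` only speaks of paths, so `x` must be joined to `x₀` by a path staying in
  -- one trivializing set whose image under `f` stays in another.
  obtain ⟨s, ⟨hs, hsc⟩, hsU⟩ := (path_connected_basis x₀).mem_iff.1 hU
  filter_upwards [hs] with x hx
  obtain ⟨γ, hγ⟩ := hsc.joinedIn x₀ (mem_of_mem_nhds hs) x hx
  let σ : SingularSimplex 1 B :=
    ⟨fun t => γ (stdSimplexHomeomorphUnitInterval t), by fun_prop⟩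
  have h0 : σ (stdSimplex.vertex 0) = x₀ := γ.source
  have h1 : σ (stdSimplex.vertex 1) = x := γ.target
  have h := hP σ
  rw [preservesOrientation_iff_of_subset x₀ σ fun t => (hsU (hγ _)).1,
    preservesOrientation_iff_of_subset (f x₀) (f.comp σ) fun t => (hsU (hγ _)).2] at h
  -- Both reference coordinates equal 1 at the starting point, so only the signs at `x` remain.
  simp only [ContinuousMap.comp_apply, h0, h1, referenceCoord_self, zero_lt_one, true_iff] at h
  exact h

/-- A linear isomorphism of fibres over `f`, continuous on the total space, forces `f` to preserve
the first Stiefel-Whitney class. -/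
theorem pullback_stiefelWhitneyClassOne_eq (f : C(B, B)) (A : ∀ x, E x →ₗ[ℝ] E (f x))
    (hinj : ∀ x, Function.Injective (A x))
    (hA : Continuous fun v : TotalSpace ℝ E => TotalSpace.mk' ℝ (f v.proj) (A v.proj v.2)) :
    H1.pullback f (stiefelWhitneyClassOne E) = stiefelWhitneyClassOne E := by
  rw [pullback_stiefelWhitneyClassOne_eq_iff]
  -- The 0-cochain records whether `A x` respects the reference orientations. A frame `s` along `σ`
  -- gives the frame `A s` along `f ∘ σ`, and the signs multiply.
  refine ⟨fun x => 0 < fibreRatio (A x (referenceVector E x)) (referenceVector E (f x)),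
    fun σ => ?_⟩
  obtain ⟨s, hs, h0⟩ := exists_frame_path (E := E) σ
  have hA0 : ∀ {x} {v : E x}, v ≠ 0 → A x v ≠ 0 := fun hv =>
    (map_ne_zero_iff _ (hinj _)).2 hv
  rw [preservesOrientation_iff σ s hs h0,
    preservesOrientation_iff (f.comp σ) (fun t => A (σ t) (s t)) (hA.comp hs) fun t => hA0 (h0 t)]
  have hmul : ∀ {x} {v : E x}, v ≠ 0 →
      fibreRatio (A x v) (referenceVector E (f x)) = fibreRatio v (referenceVector E x) *
        fibreRatio (A x (referenceVector E x)) (referenceVector E (f x)) := by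
    intro x v _
    apply fibreRatio_of_eq_smul (referenceVector_ne_zero E _)
    rw [mul_smul, fibreRatio_smul _ (referenceVector_ne_zero E _), ← map_smul,
      fibreRatio_smul _ (referenceVector_ne_zero E _)]
  have hsign : ∀ {a b c d : ℝ}, a ≠ 0 → b ≠ 0 → c ≠ 0 → d ≠ 0 →
      (((0 < a * c ↔ 0 < b * d) ↔ (0 < a ↔ 0 < b)) ↔ (0 < c ↔ 0 < d)) := by
    intro a b c d ha hb hc hd
    rcases ha.lt_or_gt with h1 | h1 <;> rcases hb.lt_or_gt with h2 | h2 <;>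
      rcases hc.lt_or_gt with h3 | h3 <;> rcases hd.lt_or_gt with h4 | h4 <;>
      simp [mul_pos_iff, h1, h2, h3, h4, h1.not_gt, h2.not_gt,
        h3.not_gt, h4.not_gt]
  have hr : ∀ x, referenceVector E x ≠ 0 := referenceVector_ne_zero E
  have := hsign (fibreRatio_ne_zero (h0 (stdSimplex.vertex 0)) (hr _))
    (fibreRatio_ne_zero (h0 (stdSimplex.vertex 1)) (hr _))
    (fibreRatio_ne_zero (hA0 (hr (σ (stdSimplex.vertex 0)))) (hr _))
    (fibreRatio_ne_zero (hA0 (hr (σ (stdSimplex.vertex 1)))) (hr _))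
  rw [← hmul (h0 _), ← hmul (h0 _)] at this
  exact this

/-! ### Lifts described by their matrix in the reference vectors -/

/-- The fibrewise linear map over `φ` whose matrix with respect to the reference vectors is `r`. -/
noncomputable def fibreMap (E : B → Type*) [∀ x, AddCommGroup (E x)] [∀ x, Module ℝ (E x)]
    [TopologicalSpace (TotalSpace ℝ E)] [∀ x, TopologicalSpace (E x)]
    [FiberBundle ℝ E] [VectorBundle ℝ ℝ E] (φ : B → B) (r : B → ℝ) (v : TotalSpace ℝ E) :
    TotalSpace ℝ E :=
  ofCoord E (φ v.proj) (r v.proj * fibreCoord v.proj v.2)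

theorem fibreMap_fibreMap {φ φ' : B → B} {r r' : B → ℝ} (hφ : ∀ x, φ' (φ x) = x)
    (hr : ∀ x, r' (φ x) * r x = 1) (v : TotalSpace ℝ E) :
    fibreMap E φ' r' (fibreMap E φ r v) = v := by
  have h : fibreMap E φ' r' (fibreMap E φ r v) =
      ofCoord E (φ' (φ v.proj)) (r' (φ v.proj) *
        fibreCoord (φ v.proj) ((r v.proj * fibreCoord v.proj v.2) • referenceVector E (φ v.proj))) :=
    rfl
  rw [h, hφ, map_smul, fibreCoord_referenceVector, smul_eq_mul, mul_one, ← mul_assoc, hr, one_mul,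
    ofCoord, fibreCoord_smul_referenceVector]

end StiefelWhitney

section Smooth

variable {n : ℕ} {M : Type*} [TopologicalSpace M] [ChartedSpace (EuclideanSpace ℝ (Fin n)) M]
  {E : M → Type*} [∀ x, AddCommGroup (E x)] [∀ x, Module ℝ (E x)]
  [TopologicalSpace (TotalSpace ℝ E)] [∀ x, TopologicalSpace (E x)]
  [FiberBundle ℝ E] [VectorBundle ℝ ℝ E]

/-- The function in `hr` is the matrix entry of the lift in the preferred trivializations at `x₀`
and `φ x₀`; the discontinuities of `r` and of the reference vectors may cancel there. -/
theorem contMDiff_fibreMap {φ : M → M} (hφ : ContMDiff (𝓡 n) (𝓡 n) ∞ φ) {r : M → ℝ}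
    (hr : ∀ x₀, ContMDiffAt (𝓡 n) 𝓘(ℝ, ℝ) ∞
      (fun x => r x * referenceCoord E (φ x₀) (φ x) / referenceCoord E x₀ x) x₀) :
    ContMDiff ((𝓡 n).prod 𝓘(ℝ, ℝ)) ((𝓡 n).prod 𝓘(ℝ, ℝ)) ∞ (fibreMap E φ r) := by
  intro v
  rw [contMDiffAt_totalSpace]
  have hp := contMDiffAt_proj (n := ∞) (IB := 𝓡 n) E (p := v)
  refine ⟨(hφ.contMDiffAt (x := v.proj)).comp v hp, ?_⟩
  have h2 := (contMDiffAt_totalSpace.1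
    (contMDiffAt_id (I := (𝓡 n).prod 𝓘(ℝ, ℝ)) (n := ∞) (x := v))).2
  refine (((hr v.proj).comp v hp).mul h2).congr_of_eventuallyEq ?_
  have hn : ∀ᶠ w : TotalSpace ℝ E in nhds v, w.proj ∈ (trivializationAt ℝ E v.proj).baseSet :=
    hp.continuousAt ((trivializationAt ℝ E v.proj).open_baseSet.mem_nhds
      (FiberBundle.mem_baseSet_trivializationAt' _))
  have hn' : ∀ᶠ w : TotalSpace ℝ E in nhds v,
      φ w.proj ∈ (trivializationAt ℝ E (φ v.proj)).baseSet :=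
    (hφ.continuous.continuousAt.comp hp.continuousAt)
      ((trivializationAt ℝ E (φ v.proj)).open_baseSet.mem_nhds
        (FiberBundle.mem_baseSet_trivializationAt' _))
  filter_upwards [hn, hn'] with w hw hw'
  have e1 : (trivializationAt ℝ E v.proj w).2 =
    fibreCoord w.proj w.2 * referenceCoord E v.proj w.proj := trivializationAt_eq hw w.2
  have e2 : (trivializationAt ℝ E (φ v.proj) (fibreMap E φ r w)).2 =
    r w.proj * fibreCoord w.proj w.2 * referenceCoord E (φ v.proj) (φ w.proj) :=
      trivializationAt_smul hw' _ _
  have h0 := referenceCoord_ne_zero hw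
  change (trivializationAt ℝ E (φ v.proj) (fibreMap E φ r w)).2 =
    r w.proj * referenceCoord E (φ v.proj) (φ w.proj) / referenceCoord E v.proj w.proj *
      (trivializationAt ℝ E v.proj w).2
  rw [e1, e2]
  field_simp

/-- The local matrix entry of the inverse lift at `y₀` is the reciprocal of that of the lift at
`ψ.symm y₀`, precomposed with `ψ.symm`. At `y₀` both reference coordinates are 1, so the entry being
inverted is a value of `r` and hence nonzero. -/
theorem contMDiffAt_inv_symm (ψ : DiffeoGroup n M) {r : M → ℝ} (hr0 : ∀ x, r x ≠ 0)
    (hr : ∀ x₀, ContMDiffAt (𝓡 n) 𝓘(ℝ, ℝ) ∞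
      (fun x => r x * referenceCoord E (ψ x₀) (ψ x) / referenceCoord E x₀ x) x₀) (y₀ : M) :
    ContMDiffAt (𝓡 n) 𝓘(ℝ, ℝ) ∞ (fun y => (r (ψ.symm y))⁻¹ *
      referenceCoord E (ψ.symm y₀) (ψ.symm y) / referenceCoord E y₀ y) y₀ := by
  have h := (hr (ψ.symm y₀)).comp y₀ ψ.symm.contMDiff.contMDiffAt
  have h' := h.inv₀ (by
    simp only [Function.comp_apply, ψ.apply_symm_apply, referenceCoord_self, mul_one, div_one]
    exact hr0 _)
  refine h'.congr_of_eventuallyEq (Filter.Eventually.of_forall fun y => ?_)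
  simp only [Function.comp_apply, ψ.apply_symm_apply]
  rw [inv_div, mul_comm (r _), div_mul_eq_div_div, div_eq_mul_inv, div_eq_mul_inv, div_eq_mul_inv]
  ring

variable (n) in
/-- The automorphism over `ψ` whose matrix with respect to the reference vectors is `r`. -/
theorem exists_aut_of_contMDiffAt (ψ : DiffeoGroup n M) {r : M → ℝ} (hr0 : ∀ x, r x ≠ 0)
    (hr : ∀ x₀, ContMDiffAt (𝓡 n) 𝓘(ℝ, ℝ) ∞
      (fun x => r x * referenceCoord E (ψ x₀) (ψ x) / referenceCoord E x₀ x) x₀) :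
    ∃ Φ : lineBundleAut n E, autBase n E Φ = ψ := by
  let Φ : TotalDiffeoGroup n E :=
    { toFun := fibreMap E ψ r
      invFun := fibreMap E ψ.symm fun y => (r (ψ.symm y))⁻¹
      left_inv := fibreMap_fibreMap ψ.symm_apply_apply fun x => by
        rw [ψ.symm_apply_apply, inv_mul_cancel₀ (hr0 x)]
      right_inv := fibreMap_fibreMap ψ.apply_symm_apply fun x => mul_inv_cancel₀ (hr0 _)
      contMDiff_toFun := contMDiff_fibreMap ψ.contMDiff hr
      contMDiff_invFun := contMDiff_fibreMap ψ.symm.contMDiff (contMDiffAt_inv_symm ψ hr0 hr) }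
  exact ⟨⟨(Φ, ψ), fun x => ⟨((r x • (fibreCoord (E := E) x).toLinearMap).smulRight
    (referenceVector E (ψ x))), fun v => rfl⟩⟩, rfl⟩

variable (n) in
-- The fibre maps of an automorphism are injective because the map of total spaces is, and together
-- they are continuous.
theorem pullback_autBase (Φ : lineBundleAut n E) :
    H1.pullback ⟨autBase n E Φ, (autBase n E Φ).continuous⟩ (stiefelWhitneyClassOne E) =
      stiefelWhitneyClassOne E := by
  choose A hA using Φ.2
  refine pullback_stiefelWhitneyClassOne_eq _ A (fun x v w h => ?_) ?_
  · have h1 : Φ.1.1 ⟨x, v⟩ = Φ.1.1 ⟨x, w⟩ := 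
      (hA x v).trans ((congrArg (TotalSpace.mk _) h).trans (hA x w).symm)
    simpa using Φ.1.1.injective h1
  · exact Φ.1.1.continuous.congr fun v => hA v.proj v.2

/-! ### A smooth fibre metric and the construction of lifts -/

variable [ContMDiffVectorBundle ∞ ℝ E (𝓡 n)]

/-- The quotient is the transition function from the trivialization at `j` to the one at `i`: the
choice of reference vector cancels. -/
theorem contMDiffAt_referenceCoord_div {i j x₀ : M}
    (hi : x₀ ∈ (trivializationAt ℝ E i).baseSet) (hj : x₀ ∈ (trivializationAt ℝ E j).baseSet) :
    ContMDiffAt (𝓡 n) 𝓘(ℝ, ℝ) ∞ (fun x => referenceCoord E i x / referenceCoord E j x) x₀ := by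
  have h := (contMDiffAt_coordChangeL (n := ∞) (IB := 𝓡 n) hj hi).clm_apply
    (contMDiffAt_const (c := (1 : ℝ)))
  refine h.congr_of_eventuallyEq ?_
  filter_upwards [(trivializationAt ℝ E i).open_baseSet.mem_nhds hi,
    (trivializationAt ℝ E j).open_baseSet.mem_nhds hj] with x hxi hxj
  have h1 := (trivializationAt ℝ E j).linearMapAt_symm (R := ℝ) hxj (1 : ℝ)
  rw [Trivialization.linearMapAt_apply, if_pos hxj, trivializationAt_eq hxj] at h1
  have h2 := (trivializationAt ℝ E j).coordChangeL_apply (R := ℝ) (trivializationAt ℝ E i)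
    ⟨hxj, hxi⟩ 1
  rw [trivializationAt_eq hxi] at h2
  refine Eq.trans ?_ h2.symm
  rw [eq_comm, eq_div_iff (referenceCoord_ne_zero hxj), mul_right_comm, h1, one_mul]

/-- A line bundle has a smooth fibre metric: `m x` is the norm of the reference vector at `x`. -/
theorem exists_norm_referenceVector [T2Space M] [SecondCountableTopology M]
    [IsManifold (𝓡 n) ∞ M] : ∃ m : M → ℝ, (∀ x, 0 < m x) ∧
      ∀ j, ContMDiffAt (𝓡 n) 𝓘(ℝ, ℝ) ∞ (fun x => m x / |referenceCoord E j x|) j := by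
  have : LocallyCompactSpace M := ChartedSpace.locallyCompactSpace (EuclideanSpace ℝ (Fin n)) M
  obtain ⟨ρ, hρ⟩ := SmoothPartitionOfUnity.exists_isSubordinate (𝓡 n) (s := Set.univ)
    isClosed_univ (fun i : M => (trivializationAt ℝ E i).baseSet)
    (fun i => (trivializationAt ℝ E i).open_baseSet)
    (fun x _ => Set.mem_iUnion.2 ⟨x, FiberBundle.mem_baseSet_trivializationAt' x⟩)
  -- The metric is `‖v‖ = ∑ ρᵢ |vᵢ|`, with `vᵢ` the coordinate of `v` in the `i`-th trivialization.
  -- No squares are needed: on a line this is smooth away from zero.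
  refine ⟨fun x => ∑ᶠ i, ρ i x • |referenceCoord E i x|, fun x => ?_, fun j => ?_⟩
  · exact ρ.finsum_smul_mem_convex (g := fun i x => |referenceCoord E i x|)
      (t := Set.Ioi (0 : ℝ)) (Set.mem_univ x)
      (fun i hi => abs_pos.2 (referenceCoord_ne_zero (hρ i (subset_closure hi)))) (convex_Ioi 0)
  -- Dividing by `|referenceCoord E j x|` turns each term into the absolute value of a nonvanishing
  -- transition function. Subordination puts `j` in the `i`-th base set whenever `j` is in the
  -- support of `ρ i`.
  · have h := ρ.contMDiffAt_finsum (n := (⊤ : ℕ∞)) (x₀ := j)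
      (g := fun i x => |referenceCoord E i x / referenceCoord E j x|) (fun i hi => by
        have hij := hρ i hi
        have hjj := FiberBundle.mem_baseSet_trivializationAt' (F := ℝ) (E := E) j
        exact (contDiffAt_abs (div_ne_zero (referenceCoord_ne_zero hij)
          (referenceCoord_ne_zero hjj))).contMDiffAt.comp j
            (contMDiffAt_referenceCoord_div (n := n) hij hjj))
    convert h using 2 with x
    rw [div_eq_mul_inv, ← smul_eq_mul, finsum_smul]
    refine finsum_congr fun i => ?_
    rw [abs_div, smul_assoc, smul_eq_mul, div_eq_mul_inv]
    rfl

variable (n) in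
-- The predicate `P` chooses one of the two isometries from each fibre at `x` to the fibre at `ψ x`;
-- transport along short paths makes the choice locally consistent.
theorem exists_aut_of_pullback_eq [T2Space M] [SecondCountableTopology M]
    [IsManifold (𝓡 n) ∞ M] (ψ : DiffeoGroup n M)
    (h : H1.pullback ⟨ψ, ψ.continuous⟩ (stiefelWhitneyClassOne E) = stiefelWhitneyClassOne E) :
    ∃ Φ : lineBundleAut n E, autBase n E Φ = ψ := by
  classical
  have : LocallyPathConnectedSpace M :=
    ChartedSpace.locallyPathConnectedSpace (EuclideanSpace ℝ (Fin n)) M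
  obtain ⟨P, hP⟩ := (pullback_stiefelWhitneyClassOne_eq_iff _).1 h
  obtain ⟨m, hm, hmc⟩ := exists_norm_referenceVector (n := n) (E := E)
  let ε : M → ℝ := fun x => if P x then 1 else -1
  have hε : ∀ x, ε x ≠ 0 := fun x => by
    by_cases hx : P x <;> simp [ε, hx]
  refine exists_aut_of_contMDiffAt n ψ (r := fun x => ε x * (m x / m (ψ x)))
    (fun x => mul_ne_zero (hε x) (div_ne_zero (hm _).ne' (hm _).ne')) fun x₀ => ?_
  have hd : ContMDiffAt (𝓡 n) 𝓘(ℝ, ℝ) ∞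
      (fun x => m (ψ x) / |referenceCoord E (ψ x₀) (ψ x)|) x₀ :=
    (hmc (ψ x₀)).comp x₀ ψ.contMDiff.contMDiffAt
  have hd0 : m (ψ x₀) / |referenceCoord E (ψ x₀) (ψ x₀)| ≠ 0 := by
    rw [referenceCoord_self, abs_one, div_one]
    exact (hm _).ne'
  -- Near `x₀` the matrix entry is the constant sign `ε x₀` times the quotient of the norms of the
  -- local unit-coordinate frames at `x` and `ψ x`.
  refine (contMDiffAt_const (c := ε x₀)).mul ((hmc x₀).div₀ hd hd0) |>.congr_of_eventuallyEq ?_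
  have hU := (trivializationAt ℝ E x₀).open_baseSet.mem_nhds
      (FiberBundle.mem_baseSet_trivializationAt' x₀)
  have hU' := ψ.continuous.continuousAt ((trivializationAt ℝ E (ψ x₀)).open_baseSet.mem_nhds
        (FiberBundle.mem_baseSet_trivializationAt' _))
  filter_upwards [eventually_iff_of_transport _ P hP x₀, hU, hU'] with x hx hxU hxU'
  have hx' : (0 < referenceCoord E (ψ x₀) (ψ x) ↔ 0 < referenceCoord E x₀ x) ↔ (P x₀ ↔ P x) := hx
  have h1 := referenceCoord_ne_zero hxU
  have h2 := referenceCoord_ne_zero (E := E) (j := ψ x₀) (x := ψ x) hxU'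
  have h3 := (hm (ψ x)).ne'
  change ε x * (m x / m (ψ x)) * referenceCoord E (ψ x₀) (ψ x) / referenceCoord E x₀ x =
    ε x₀ * (m x / |referenceCoord E x₀ x| / (m (ψ x) / |referenceCoord E (ψ x₀) (ψ x)|))
  generalize referenceCoord E (ψ x₀) (ψ x) = b at *
  generalize referenceCoord E x₀ x = a at *
  -- By `hx'`, `a` and `b` have equal signs exactly when `ε x = ε x₀`, so the sign of `b / a`
  -- compensates the jump of `ε`.
  have hs : ε x * (b / a) = ε x₀ * (|b| / |a|) := by
    by_cases p : P x <;> by_cases q : P x₀ <;> rcases h1.lt_or_gt with ha | ha <;>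
      rcases h2.lt_or_gt with hb | hb <;>
      simp_all [ε, abs_of_pos, abs_of_neg, not_lt_of_gt, neg_div, div_neg]
  calc ε x * (m x / m (ψ x)) * b / a = ε x * (b / a) * (m x / m (ψ x)) := by ring
    _ = ε x₀ * (|b| / |a|) * (m x / m (ψ x)) := by rw [hs]
    _ = _ := by field_simp

/-! ### Scalings and the kernel of the projection to the base -/

variable (n E) in
theorem scaling_injective : Function.Injective (scaling n E) := by
  intro f g h
  refine Units.ext (ContMDiffMap.ext fun x => ?_)
  have h1 : (scaling n E f).1.1 ⟨x, referenceVector E x⟩ =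
      (scaling n E g).1.1 ⟨x, referenceVector E x⟩ := by rw [h]
  have h2 : (⟨x, f.1 x • referenceVector E x⟩ : TotalSpace ℝ E) =
    ⟨x, g.1 x • referenceVector E x⟩ := h1
  exact smul_left_injective ℝ (referenceVector_ne_zero E x) (by simpa using h2)

/-- An automorphism over the identity is the multiplication by a smooth nowhere zero function. -/
theorem exists_scaling_eq (Φ : lineBundleAut n E) (h : autBase n E Φ = 1) :
    ∃ f, scaling n E f = Φ := by
  obtain ⟨⟨Φ, ψ⟩, hΦ⟩ := Φ
  obtain rfl : ψ = 1 := h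
  have hΦ' : ∀ x, ∃ A : E x →ₗ[ℝ] E x, ∀ v, Φ ⟨x, v⟩ = ⟨x, A v⟩ := hΦ
  choose A hA using hΦ'
  let f : M → ℝ := fun x => fibreCoord x (A x (referenceVector E x))
  have hf : ∀ x v, A x v = f x • v := fun x v => by
    conv_lhs => rw [← fibreCoord_smul_referenceVector v, map_smul,
      ← fibreCoord_smul_referenceVector (A x (referenceVector E x))]
    rw [smul_comm, fibreCoord_smul_referenceVector]
  have hf0 : ∀ x, f x ≠ 0 := fun x h0 => by
    have h1 : Φ ⟨x, referenceVector E x⟩ = Φ ⟨x, 0⟩ := by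
      rw [hA, hA, hf, h0, zero_smul, map_zero]
    exact referenceVector_ne_zero E x (by simpa using Φ.injective h1)
  have hfc : ContMDiff (𝓡 n) 𝓘(ℝ, ℝ) ∞ f := by
    intro x₀
    have hx₀ := FiberBundle.mem_baseSet_trivializationAt' (F := ℝ) (E := E) x₀
    have hU := (trivializationAt ℝ E x₀).open_baseSet.mem_nhds hx₀
    have hone : ∀ x ∈ (trivializationAt ℝ E x₀).baseSet,
        (trivializationAt ℝ E x₀ ⟨x, (trivializationAt ℝ E x₀).symm x (1 : ℝ)⟩).2 = 1 := by
      intro x hx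
      have h1 := (trivializationAt ℝ E x₀).linearMapAt_symm (R := ℝ) hx (1 : ℝ)
      rwa [Trivialization.linearMapAt_apply, if_pos hx] at h1
    -- The local section of constant coordinate 1 is smooth, and the coordinate of its image under
    -- `Φ` is `f`; the reference vector itself could not be used here, as it need not be smooth in
    -- `x`.
    have hs : ContMDiffAt (𝓡 n) ((𝓡 n).prod 𝓘(ℝ, ℝ)) ∞ (fun x => TotalSpace.mk' ℝ x
        ((trivializationAt ℝ E x₀).symm x (1 : ℝ))) x₀ := by
      rw [(trivializationAt ℝ E x₀).contMDiffAt_section_iff hx₀]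
      refine (contMDiffAt_const (c := (1 : ℝ))).congr_of_eventuallyEq ?_
      filter_upwards [hU] with x hx using hone x hx
    have hc := (contMDiffAt_totalSpace.1 (Φ.contMDiff.contMDiffAt.comp x₀ hs)).2
    refine hc.congr_of_eventuallyEq ?_
    filter_upwards [hU] with x hx
    simp only [Function.comp_apply, TotalSpace.mk', hA, hf]
    rw [trivializationAt_smul hx, hone x hx, mul_one]
  obtain ⟨u, hu⟩ := (isUnit_iff_nowhereVanishing (n := n) ⟨f, hfc⟩).2 hf0
  refine ⟨u, lineBundleAut_ext n E _ _ (Diffeomorph.ext fun v => ?_)⟩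
  change (⟨v.proj, u.1 v.proj • v.2⟩ : TotalSpace ℝ E) = Φ ⟨v.proj, v.2⟩
  rw [hu, hA, hf]
  rfl

end Smooth

end RealLineBundle

/-! ### The lifting criterion and the exact sequence -/

theorem mainTheorem12 (n : ℕ) (M : Type*) [TopologicalSpace M] [T2Space M]
    [SecondCountableTopology M] [ChartedSpace (EuclideanSpace ℝ (Fin n)) M]
    [IsManifold (𝓡 n) ∞ M]
    (E : M → Type*) [∀ x, AddCommGroup (E x)] [∀ x, Module ℝ (E x)]
    [TopologicalSpace (Bundle.TotalSpace ℝ E)] [∀ x, TopologicalSpace (E x)]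
    [FiberBundle ℝ E] [VectorBundle ℝ ℝ E] [ContMDiffVectorBundle ∞ ℝ E (𝓡 n)] :
    (∀ ψ : RealLineBundle.DiffeoGroup n M,
      (∃ Φ : RealLineBundle.lineBundleAut n E, RealLineBundle.autBase n E Φ = ψ) ↔
        RealLineBundle.H1.pullback ⟨ψ, ψ.continuous⟩
          (RealLineBundle.stiefelWhitneyClassOne E) =
            RealLineBundle.stiefelWhitneyClassOne E) ∧
    ∃ p : RealLineBundle.lineBundleAut n E →*
        RealLineBundle.stabilizer n M (RealLineBundle.stiefelWhitneyClassOne E),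
      (∀ Φ, (p Φ : RealLineBundle.DiffeoGroup n M) = RealLineBundle.autBase n E Φ) ∧
      Function.Injective (RealLineBundle.scaling n E) ∧
      (RealLineBundle.scaling n E).range = p.ker ∧
      Function.Surjective p := by
  have hiff : ∀ ψ : RealLineBundle.DiffeoGroup n M,
      (∃ Φ : RealLineBundle.lineBundleAut n E, RealLineBundle.autBase n E Φ = ψ) ↔
        RealLineBundle.H1.pullback ⟨ψ, ψ.continuous⟩
          (RealLineBundle.stiefelWhitneyClassOne E) =
            RealLineBundle.stiefelWhitneyClassOne E := fun ψ =>
    ⟨by rintro ⟨Φ, rfl⟩; exact RealLineBundle.pullback_autBase n Φ,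
      RealLineBundle.exists_aut_of_pullback_eq n ψ⟩
  -- One direction of the criterion lets the projection land in the stabilizer; the other gives
  -- surjectivity below.
  refine ⟨hiff, (RealLineBundle.autBase n E).codRestrict _
    (RealLineBundle.pullback_autBase n), fun _ => rfl, RealLineBundle.scaling_injective n E,
    ?_, ?_⟩
  · ext Φ
    rw [MonoidHom.mem_range, MonoidHom.mem_ker]
    constructor
    · rintro ⟨f, rfl⟩
      rfl
    · intro h
      exact RealLineBundle.exists_scaling_eq Φ (congrArg Subtype.val h)
  · rintro ⟨ψ, hψ⟩
    obtain ⟨Φ, hΦ⟩ := (hiff ψ).2 hψ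
    exact ⟨Φ, Subtype.ext hΦ⟩
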